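/- For each integer $n\ge 1$ let $a_n$ be the number of subrings of $\mathbb{Z}[t]/(t^3)$ that contain the identity element $1$ and whose additive group has index $n$ in $\mathbb{Z}[t]/(t^3)$; each $a_n$ is finite. Then, as $B\to\infty$ through the real numbers, $$\sum_{1\le n\le B} a_n \;\sim\; \frac{1}{12\,\zeta(2)}\, B\,(\ln B)^2,$$ where $\zeta$ is the Riemann zeta function; that is, the ratio of the two sides tends to $1$. -/

import Mathlib

/-- The ring `ℤ[t]/(t³)`. -/
abbrev TruncRing : Type :=
  Polynomial ℤ ⧸ Ideal.span {(Polynomial.X ^ 3 : Polynomial ℤ)}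

/-- The set of subrings with identity of `ℤ[t]/(t³)` whose additive group has index `n`.
For `n ≥ 1` this means that the quotient group has exactly `n` elements; in Mathlib, index `0`
stands for infinite index. -/
def subringsOfIndex (n : ℕ) : Set (Subring TruncRing) :=
  {S | S.toAddSubgroup.index = n}

/-- The number `a_n` of subrings with identity of `ℤ[t]/(t³)` of index `n`. -/
noncomputable def subringCount (n : ℕ) : ℕ :=
  (subringsOfIndex n).ncard

/-! A finite-index subring is `ℤ + ℤ(at + bt²) + ℤdt²` with `0 ≤ b < d`. Since `(at + bt²)² = a²t²`,
closure under multiplication means `d ∣ a²`, and the index is `ad`. Hence `a_n` is the sum of the `d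
∣ n` with `d ∣ (n/d)²` (`subringCount_eq`). Writing `d = ql²` with `q` squarefree turns the
condition into `q²l³ ∣ n`, so that `∑_{n ≤ B} a_n = ∑_{l,q} ql²⌊B/(q²l³)⌋` (`sum_subringCount`).

Dropping the floor leaves `(B/l) ∑ 1/q` over squarefree `q ≤ √(B/l³)`, with error `O(B/l)`. The sum
of `1/q` up to `y` is `log y / ζ(2) + O(1)`, by Möbius inversion. Summing `(B/2ζ(2)) (log B - 3 log
l)/l` over `l ≤ B^(1/3)` gives the factor `1/3 - 1/6 = 1/6`, hence the constant `1/(12ζ(2))`; all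
errors are `O(B(1 + log B))`. -/

/-! ### Coordinates on `ℤ[t]/(t³)` -/

open Polynomial in
/-- The coefficient of `t ^ i` of an element of `ℤ[t]/(t³)`, for `i < 3`. -/
noncomputable def truncCoeff (i : Fin 3) : TruncRing →+ ℤ :=
  QuotientAddGroup.lift _ (lcoeff ℤ (i : ℕ)).toAddMonoidHom (by
    intro p hp
    have h : (X ^ 3 : ℤ[X]) ∣ p := Ideal.mem_span_singleton.1 hp
    exact X_pow_dvd_iff.1 h i i.2)

open Polynomial in
theorem truncCoeff_mk (i : Fin 3) (p : ℤ[X]) :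
    truncCoeff i (Ideal.Quotient.mk _ p) = p.coeff i := rfl

open Polynomial in
theorem truncRing_ext {x y : TruncRing} (h : ∀ i, truncCoeff i x = truncCoeff i y) : x = y := by
  obtain ⟨p, rfl⟩ := Ideal.Quotient.mk_surjective x
  obtain ⟨q, rfl⟩ := Ideal.Quotient.mk_surjective y
  rw [Ideal.Quotient.eq, Ideal.mem_span_singleton, X_pow_dvd_iff]
  intro d hd
  have := h ⟨d, hd⟩
  simp only [truncCoeff_mk] at this
  simp [this]

open Polynomial in
theorem truncCoeff_zero_mul (x y : TruncRing) :
    truncCoeff 0 (x * y) = truncCoeff 0 x * truncCoeff 0 y := by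
  obtain ⟨p, rfl⟩ := Ideal.Quotient.mk_surjective x
  obtain ⟨q, rfl⟩ := Ideal.Quotient.mk_surjective y
  rw [← map_mul, truncCoeff_mk, truncCoeff_mk, truncCoeff_mk]
  simp

open Polynomial in
theorem truncCoeff_one_mul (x y : TruncRing) :
    truncCoeff 1 (x * y) =
      truncCoeff 0 x * truncCoeff 1 y + truncCoeff 1 x * truncCoeff 0 y := by
  obtain ⟨p, rfl⟩ := Ideal.Quotient.mk_surjective x
  obtain ⟨q, rfl⟩ := Ideal.Quotient.mk_surjective y
  rw [← map_mul]
  simp only [truncCoeff_mk]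
  simp [coeff_mul, Finset.Nat.antidiagonal_succ]

open Polynomial in
theorem truncCoeff_two_mul (x y : TruncRing) :
    truncCoeff 2 (x * y) =
      truncCoeff 0 x * truncCoeff 2 y + truncCoeff 1 x * truncCoeff 1 y +
        truncCoeff 2 x * truncCoeff 0 y := by
  obtain ⟨p, rfl⟩ := Ideal.Quotient.mk_surjective x
  obtain ⟨q, rfl⟩ := Ideal.Quotient.mk_surjective y
  rw [← map_mul]
  simp only [truncCoeff_mk]
  simp [coeff_mul, Finset.Nat.antidiagonal_succ, add_assoc]

open Polynomial in
/-- The element `a t + b t²` of `ℤ[t]/(t³)`. -/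
noncomputable def truncLin (a b : ℤ) : TruncRing :=
  Ideal.Quotient.mk _ (C a * X + C b * X ^ 2)

@[simp] theorem truncCoeff_zero_truncLin (a b : ℤ) : truncCoeff 0 (truncLin a b) = 0 := by
  rw [truncLin, truncCoeff_mk]
  simp

@[simp] theorem truncCoeff_one_truncLin (a b : ℤ) : truncCoeff 1 (truncLin a b) = a := by
  rw [truncLin, truncCoeff_mk]
  simp [-eq_intCast, Polynomial.coeff_X_pow]

@[simp] theorem truncCoeff_two_truncLin (a b : ℤ) : truncCoeff 2 (truncLin a b) = b := by
  rw [truncLin, truncCoeff_mk]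
  simp [-eq_intCast]

@[simp] theorem truncCoeff_intCast (m : ℤ) (i : Fin 3) :
    truncCoeff i (m : TruncRing) = if i = 0 then m else 0 := by
  rw [← map_intCast (Ideal.Quotient.mk (Ideal.span {(Polynomial.X ^ 3 : Polynomial ℤ)})) m,
    truncCoeff_mk, ← Polynomial.C_eq_intCast, Polynomial.coeff_C]
  fin_cases i <;> simp

/-! ### The standard subrings and their index -/

/-- The subring `ℤ + ℤ (a t + b t²) + ℤ d t²` of `ℤ[t]/(t³)`. -/
noncomputable def truncSubring (a b d : ℤ) (h : d ∣ a ^ 2) : Subring TruncRing where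
  carrier := {x | ∃ u, truncCoeff 1 x = a * u ∧ d ∣ truncCoeff 2 x - b * u}
  zero_mem' := ⟨0, by simp⟩
  one_mem' := ⟨0, by
    have := truncCoeff_intCast 1
    simp only [Int.cast_one] at this
    simp [this]⟩
  add_mem' := by
    rintro x y ⟨u, hu, s, hs⟩ ⟨v, hv, r, hr⟩
    refine ⟨u + v, by rw [map_add, hu, hv]; ring, s + r, ?_⟩
    rw [map_add]
    linear_combination hs + hr
  neg_mem' := by
    rintro x ⟨u, hu, s, hs⟩
    refine ⟨-u, by rw [map_neg, hu]; ring, -s, ?_⟩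
    rw [map_neg]
    linear_combination -hs
  mul_mem' := by
    rintro x y ⟨u, hu, s, hs⟩ ⟨v, hv, r, hr⟩
    -- The product contributes `a²uv` to the coefficient of `t²`; `d ∣ a²` absorbs it.
    obtain ⟨k, hk⟩ := h
    refine ⟨truncCoeff 0 x * v + truncCoeff 0 y * u, ?_,
      truncCoeff 0 x * r + truncCoeff 0 y * s + k * u * v, ?_⟩
    · rw [truncCoeff_one_mul, hu, hv]; ring
    · rw [truncCoeff_two_mul, hu, hv]
      linear_combination truncCoeff 0 y * hs + truncCoeff 0 x * hr + u * v * hk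

theorem mem_truncSubring {a b d : ℤ} {h : d ∣ a ^ 2} {x : TruncRing} :
    x ∈ truncSubring a b d h ↔
      ∃ u, truncCoeff 1 x = a * u ∧ d ∣ truncCoeff 2 x - b * u := Iff.rfl

theorem truncLin_zero_mem_truncSubring {a b d : ℤ} (ha : a ≠ 0) {h : d ∣ a ^ 2} {c : ℤ} :
    truncLin 0 c ∈ truncSubring a b d h ↔ d ∣ c := by
  rw [mem_truncSubring]
  simp [ha]

theorem truncLin_mem_truncSubring {a b d : ℤ} (ha : a ≠ 0) {h : d ∣ a ^ 2} {c : ℤ} :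
    truncLin a c ∈ truncSubring a b d h ↔ d ∣ c - b := by
  rw [mem_truncSubring]
  constructor
  · rintro ⟨u, hu, hd⟩
    have : u = 1 := by
      simp only [truncCoeff_one_truncLin] at hu
      exact mul_left_cancel₀ ha (by linarith)
    simpa [this] using hd
  · intro hd
    exact ⟨1, by simpa using hd⟩

/-- The elements whose coefficient of `t` is divisible by `a`. -/
noncomputable def truncDvd (a : ℕ) : AddSubgroup TruncRing :=
  ((Int.castAddHom (ZMod a)).comp (truncCoeff 1)).ker

theorem mem_truncDvd {a : ℕ} {x : TruncRing} : x ∈ truncDvd a ↔ (a : ℤ) ∣ truncCoeff 1 x := by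
  simp [truncDvd, AddMonoidHom.mem_ker, ZMod.intCast_zmod_eq_zero_iff_dvd]

theorem truncDvd_index (a : ℕ) : (truncDvd a).index = a := by
  rw [truncDvd, AddSubgroup.index_ker, AddMonoidHom.range_eq_top.2, AddSubgroup.card_top,
    Nat.card_zmod]
  intro z
  obtain ⟨m, rfl⟩ := ZMod.intCast_surjective z
  exact ⟨truncLin m 0, by simp⟩

/-- The index is multiplicative through the intermediate group `truncDvd a`, of index `a`; inside it
the subring is the kernel of a surjection `ψ` onto `ZMod d`. -/
theorem truncSubring_index {a : ℕ} (ha : a ≠ 0) (b : ℤ) (d : ℕ) (h : (d : ℤ) ∣ (a : ℤ) ^ 2) :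
    (truncSubring a b d h).toAddSubgroup.index = a * d := by
  have ha' : (a : ℤ) ≠ 0 := by exact_mod_cast ha
  have hle : (truncSubring a b d h).toAddSubgroup ≤ truncDvd a := by
    rintro x ⟨u, hu, -⟩
    exact mem_truncDvd.2 ⟨u, hu⟩
  rw [← AddSubgroup.relIndex_mul_index hle, truncDvd_index, mul_comm]
  congr 1
  let ψ : truncDvd a →+ ZMod d := AddMonoidHom.mk'
    (fun x => ((truncCoeff 2 (x : TruncRing) - b * (truncCoeff 1 (x : TruncRing) / a) : ℤ) :
      ZMod d)) (by
    rintro ⟨x, hx⟩ ⟨y, hy⟩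
    simp only [AddSubgroup.coe_add, map_add]
    rw [Int.add_ediv_of_dvd_left (mem_truncDvd.1 hx)]
    push_cast
    ring)
  have hker : (truncSubring a b d h).toAddSubgroup.addSubgroupOf (truncDvd a) = ψ.ker := by
    ext ⟨x, hx⟩
    obtain ⟨u, hu⟩ := mem_truncDvd.1 hx
    rw [AddSubgroup.mem_addSubgroupOf, AddMonoidHom.mem_ker]
    change x ∈ truncSubring a b d h ↔
      ((truncCoeff 2 x - b * (truncCoeff 1 x / a) : ℤ) : ZMod d) = 0
    rw [ZMod.intCast_zmod_eq_zero_iff_dvd, mem_truncSubring, hu, Int.mul_ediv_cancel_left _ ha']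
    constructor
    · rintro ⟨v, hv, hd⟩
      rwa [mul_left_cancel₀ ha' hv]
    · intro hd
      exact ⟨u, rfl, hd⟩
  rw [AddSubgroup.relIndex, hker, AddSubgroup.index_ker, AddMonoidHom.range_eq_top.2,
    AddSubgroup.card_top, Nat.card_zmod]
  intro z
  obtain ⟨m, rfl⟩ := ZMod.intCast_surjective z
  refine ⟨⟨truncLin 0 m, mem_truncDvd.2 (by simp)⟩, ?_⟩
  change ((truncCoeff 2 (truncLin 0 m) - b * (truncCoeff 1 (truncLin 0 m) / a) : ℤ) : ZMod d) = m
  simp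

/-! ### Classification of the subrings of finite index -/

theorem AddSubgroup.exists_nat_dvd_iff (H : AddSubgroup ℤ) : ∃ d : ℕ, ∀ z, z ∈ H ↔ (d : ℤ) ∣ z := by
  obtain ⟨a, ha⟩ := Int.subgroup_cyclic H
  refine ⟨a.natAbs, fun z => ?_⟩
  rw [ha, ← AddSubgroup.zmultiples_eq_closure, Int.mem_zmultiples_iff, Int.natAbs_dvd]

theorem intCast_add_truncLin (x : TruncRing) :
    (truncCoeff 0 x : TruncRing) + truncLin (truncCoeff 1 x) (truncCoeff 2 x) = x := by
  apply truncRing_ext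
  intro i
  fin_cases i <;> simp

theorem Subring.mem_iff_truncLin_mem (S : Subring TruncRing) (x : TruncRing) :
    x ∈ S ↔ truncLin (truncCoeff 1 x) (truncCoeff 2 x) ∈ S := by
  conv_lhs => rw [← intCast_add_truncLin x]
  exact S.add_mem_cancel_left (intCast_mem S _)

/-- Every subring of finite index is one of the subrings `truncSubring`. -/
theorem Subring.exists_eq_truncSubring (S : Subring TruncRing) {n : ℕ} (hn : n ≠ 0)
    (hS : S.toAddSubgroup.index = n) :
    ∃ a b d : ℕ, ∃ h : (d : ℤ) ∣ (a : ℤ) ^ 2, a * d = n ∧ b < d ∧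
      S = truncSubring a b d h := by
  have hlin : ∀ a b c e : ℤ, truncLin (a + c) (b + e) = truncLin a b + truncLin c e := by
    intro a b c e
    apply truncRing_ext
    intro i
    fin_cases i <;> simp
  have hsmul : ∀ m a b : ℤ, truncLin (m * a) (m * b) = m • truncLin a b := by
    intro m a b
    apply truncRing_ext
    intro i
    rw [map_zsmul]
    fin_cases i <;> simp
  -- Finite index enters here: it forces the generators `a` and `d` below to be nonzero.
  have hmem : ∀ x : TruncRing, n • x ∈ S := by
    intro x
    have := S.toAddSubgroup.nsmul_index_mem x
    rwa [hS] at this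
  obtain ⟨a, ha⟩ := (S.toAddSubgroup.map (truncCoeff 1)).exists_nat_dvd_iff
  let J : AddSubgroup ℤ := S.toAddSubgroup.comap (AddMonoidHom.mk' (truncLin 0) (by
    intro x y; simpa using hlin 0 x 0 y))
  obtain ⟨d, hd⟩ := J.exists_nat_dvd_iff
  replace hd : ∀ z, truncLin 0 z ∈ S ↔ (d : ℤ) ∣ z := hd
  have hn' : (n : ℤ) ≠ 0 := by exact_mod_cast hn
  have ha0 : a ≠ 0 := by
    rintro rfl
    have : (n : ℤ) ∈ S.toAddSubgroup.map (truncCoeff 1) :=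
      ⟨_, hmem (truncLin 1 0), by rw [map_nsmul]; simp⟩
    rw [ha] at this
    exact hn' (by simpa using this)
  have hd0 : d ≠ 0 := by
    rintro rfl
    have h1 := hmem (truncLin 0 1)
    rw [← natCast_zsmul, ← hsmul, mul_zero, mul_one, hd] at h1
    exact hn' (by simpa using h1)
  obtain ⟨x, hxS, hx⟩ := (ha a).2 dvd_rfl
  replace hxS : x ∈ S := hxS
  rw [Subring.mem_iff_truncLin_mem, hx] at hxS
  set c := truncCoeff 2 x
  have hda : (d : ℤ) ∣ (a : ℤ) ^ 2 := by
    rw [← hd]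
    convert S.mul_mem hxS hxS using 1
    apply truncRing_ext
    intro i
    fin_cases i
    · simp [truncCoeff_zero_mul]
    · simp [truncCoeff_one_mul]
    · simp [truncCoeff_two_mul, sq]
  have hd0' : (d : ℤ) ≠ 0 := by exact_mod_cast hd0
  -- As `dt² ∈ S`, only the class of `c` modulo `d` matters.
  have hb : ((c % d).toNat : ℤ) = c % d := Int.toNat_of_nonneg (Int.emod_nonneg _ hd0')
  have hlt : (c % d).toNat < d := by
    zify
    rw [hb]
    exact Int.emod_lt_of_pos _ (by positivity)
  have hbS : truncLin a (c % d) ∈ S := by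
    have h1 : truncLin 0 (-(d * (c / d))) ∈ S := (hd _).2 ((dvd_mul_right _ _).neg_right)
    have h2 := S.add_mem hxS h1
    rw [← hlin, add_zero] at h2
    convert h2 using 2
    rw [Int.emod_def]
    ring
  have hEq : S = truncSubring a (c % d).toNat d hda := by
    ext y
    rw [mem_truncSubring, hb]
    have key : ∀ u : ℤ, truncCoeff 1 y = a * u →
        (y ∈ S ↔ (d : ℤ) ∣ truncCoeff 2 y - (c % d) * u) := by
      intro u hu
      rw [Subring.mem_iff_truncLin_mem, ← hd, hu]
      have h1 : truncLin (a * u) (truncCoeff 2 y) =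
          u • truncLin a (c % d) + truncLin 0 (truncCoeff 2 y - (c % d) * u) := by
        rw [← hsmul, ← hlin]
        congr 1 <;> ring
      rw [h1]
      exact S.add_mem_cancel_left (S.zsmul_mem hbS u)
    constructor
    · intro hy
      obtain ⟨u, hu⟩ := (ha _).1 ⟨y, hy, rfl⟩
      exact ⟨u, hu, (key u hu).1 hy⟩
    · rintro ⟨u, hu, h⟩
      exact (key u hu).2 h
  refine ⟨a, (c % d).toNat, d, hda, ?_, hlt, hEq⟩
  rw [← hS, hEq, truncSubring_index ha0]

/-! ### The divisor-sum formula for `a_n` -/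

/-- The parameters `(d, b)` of the subrings of index `n`. -/
def truncParams (n : ℕ) : Finset (Σ _ : ℕ, ℕ) :=
  (n.divisors.filter fun d => d ∣ (n / d) ^ 2).sigma fun d => Finset.range d

theorem dvd_of_mem_truncParams {n : ℕ} {p : Σ _ : ℕ, ℕ} (hp : p ∈ truncParams n) :
    (p.1 : ℤ) ∣ ((n / p.1 : ℕ) : ℤ) ^ 2 := by
  simp only [truncParams, Finset.mem_sigma, Finset.mem_filter] at hp
  exact_mod_cast hp.1.2

theorem mem_subringsOfIndex_iff {n : ℕ} (hn : n ≠ 0) (S : Subring TruncRing) :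
    S ∈ subringsOfIndex n ↔ ∃ (p : Σ _ : ℕ, ℕ) (hp : p ∈ truncParams n),
      truncSubring (n / p.1 : ℕ) p.2 p.1 (dvd_of_mem_truncParams hp) = S := by
  constructor
  · intro hS
    obtain ⟨a, b, d, h, had, hbd, rfl⟩ := S.exists_eq_truncSubring hn hS
    have hd : 0 < d := by omega
    have hdiv : n / d = a := by rw [← had, Nat.mul_div_cancel _ hd]
    refine ⟨⟨d, b⟩, ?_, ?_⟩
    · simp only [truncParams, Finset.mem_sigma, Finset.mem_filter, Nat.mem_divisors,
        Finset.mem_range]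
      exact ⟨⟨⟨⟨a, by rw [← had, mul_comm]⟩, hn⟩, by rw [hdiv]; exact_mod_cast h⟩, hbd⟩
    · simp only [hdiv]
  · rintro ⟨⟨d, b⟩, hp, rfl⟩
    have hp' := hp
    simp only [truncParams, Finset.mem_sigma, Finset.mem_filter, Nat.mem_divisors] at hp'
    have hdn := hp'.1.1.1
    have : n / d ≠ 0 := (Nat.div_pos (Nat.le_of_dvd (Nat.pos_of_ne_zero hn) hdn)
      (Nat.pos_of_dvd_of_pos hdn (Nat.pos_of_ne_zero hn))).ne'
    change AddSubgroup.index _ = n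
    rw [truncSubring_index this, Nat.div_mul_cancel hdn]

theorem subringsOfIndex_finite {n : ℕ} (hn : n ≠ 0) : (subringsOfIndex n).Finite := by
  refine ((truncParams n).finite_toSet.dependent_image fun p hp =>
    truncSubring (n / p.1 : ℕ) p.2 p.1 (dvd_of_mem_truncParams hp)).subset fun S hS => ?_
  exact (mem_subringsOfIndex_iff hn S).1 hS

/-- The subring determines its parameters: `d` through its multiples of `t²`, and `b` modulo `d`
through its elements `at + ct²`. Each `d` is weighted by its `d` choices of `b`. -/
theorem subringCount_eq {n : ℕ} (hn : n ≠ 0) :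
    subringCount n = ∑ d ∈ n.divisors with d ∣ (n / d) ^ 2, d := by
  have hcard : (truncParams n : Set (Σ _ : ℕ, ℕ)).ncard = (subringsOfIndex n).ncard := by
    refine Set.ncard_congr (fun p hp =>
      truncSubring (n / p.1 : ℕ) p.2 p.1 (dvd_of_mem_truncParams hp)) ?_ ?_ ?_
    · intro p hp
      exact (mem_subringsOfIndex_iff hn _).2 ⟨p, hp, rfl⟩
    · rintro ⟨d, b⟩ ⟨e, c⟩ hp hq heq
      have hp' := hp
      have hq' := hq
      simp only [truncParams, Finset.mem_coe, Finset.mem_sigma, Finset.mem_filter,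
        Nat.mem_divisors, Finset.mem_range] at hp' hq'
      have hpos : ∀ {k}, k ∣ n → ((n / k : ℕ) : ℤ) ≠ 0 := fun {k} hk => by
        exact_mod_cast (Nat.div_pos (Nat.le_of_dvd (Nat.pos_of_ne_zero hn) hk)
          (Nat.pos_of_dvd_of_pos hk (Nat.pos_of_ne_zero hn))).ne'
      have hmem : ∀ z : ℤ, (d : ℤ) ∣ z ↔ (e : ℤ) ∣ z := by
        intro z
        rw [← truncLin_zero_mem_truncSubring (hpos hp'.1.1.1) (b := b)
          (h := dvd_of_mem_truncParams hp),
          ← truncLin_zero_mem_truncSubring (hpos hq'.1.1.1) (b := c)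
          (h := dvd_of_mem_truncParams hq)]
        simp only at heq
        rw [heq]
      obtain rfl : d = e := Nat.dvd_antisymm
        (Int.natCast_dvd_natCast.1 ((hmem e).2 dvd_rfl))
        (Int.natCast_dvd_natCast.1 ((hmem d).1 dvd_rfl))
      have hbc : (d : ℤ) ∣ b - c := by
        rw [← truncLin_mem_truncSubring (hpos hq'.1.1.1) (h := dvd_of_mem_truncParams hq)]
        simp only at heq
        rw [← heq, truncLin_mem_truncSubring (hpos hp'.1.1.1)]
        simp
      have := Int.eq_zero_of_abs_lt_dvd hbc (by rw [abs_lt]; omega)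
      obtain rfl : b = c := by omega
      rfl
    · intro S hS
      exact (mem_subringsOfIndex_iff hn S).1 hS
  rw [subringCount, ← hcard, Set.ncard_coe_finset, truncParams, Finset.card_sigma]
  simp

/-! ### Squarefree decomposition and the double sum -/

theorem Squarefree.sq_dvd_mul_sq_iff {q j l : ℕ} (hq : Squarefree q) (hl : l ≠ 0) :
    j ^ 2 ∣ q * l ^ 2 ↔ j ∣ l := by
  refine ⟨fun h => ?_, fun h => (pow_dvd_pow_of_dvd h 2).mul_left q⟩
  -- After removing the gcd, `j'²` is coprime to `l'²`, so it divides the squarefree `q`.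
  obtain ⟨g, j', l', hg, hcop, rfl, rfl⟩ :=
    Nat.exists_coprime' (Nat.gcd_pos_of_pos_right j (Nat.pos_of_ne_zero hl))
  have h1 : j' ^ 2 ∣ q * l' ^ 2 := by
    refine Nat.dvd_of_mul_dvd_mul_right (pow_pos hg 2) ?_
    convert h using 1 <;> ring
  have h2 : j' ^ 2 ∣ q := (hcop.pow 2 2).dvd_of_dvd_mul_right h1
  have h3 : j' = 1 := Nat.isUnit_iff.1 (hq j' (by rwa [← sq]))
  rw [h3, one_mul]
  exact dvd_mul_left _ _

theorem Squarefree.mul_sq_inj {q l r m : ℕ} (hq : Squarefree q) (hr : Squarefree r)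
    (hl : l ≠ 0) (hm : m ≠ 0) (h : q * l ^ 2 = r * m ^ 2) : q = r ∧ l = m := by
  have hlm : l = m := Nat.dvd_antisymm
    ((hr.sq_dvd_mul_sq_iff hm).1 (h ▸ dvd_mul_left _ _))
    ((hq.sq_dvd_mul_sq_iff hl).1 (h ▸ dvd_mul_left _ _))
  subst hlm
  exact ⟨Nat.eq_of_mul_eq_mul_right (by positivity) h, rfl⟩

theorem Squarefree.mul_sq_dvd_sq_iff {q l a : ℕ} (hq : Squarefree q) (hl : l ≠ 0) :
    q * l ^ 2 ∣ a ^ 2 ↔ q * l ∣ a := by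
  constructor
  · intro h
    obtain ⟨c, rfl⟩ : l ∣ a := (Nat.pow_dvd_pow_iff two_ne_zero).1 ((dvd_mul_left _ _).trans h)
    have h1 : q ∣ c ^ 2 := by
      refine Nat.dvd_of_mul_dvd_mul_right (show 0 < l ^ 2 by positivity) ?_
      convert h using 1; ring
    rw [mul_comm]
    exact mul_dvd_mul_left l ((hq.dvd_pow_iff_dvd two_ne_zero).1 h1)
  · rintro ⟨c, rfl⟩
    exact ⟨q * c ^ 2, by ring⟩

theorem Squarefree.dvd_and_dvd_div_sq_iff {q l n : ℕ} (hq : Squarefree q) (hl : l ≠ 0) :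
    (q * l ^ 2 ∣ n ∧ q * l ^ 2 ∣ (n / (q * l ^ 2)) ^ 2) ↔ q ^ 2 * l ^ 3 ∣ n := by
  have hpos : 0 < q * l ^ 2 := by have := hq.ne_zero; positivity
  rw [hq.mul_sq_dvd_sq_iff hl]
  have he : q ^ 2 * l ^ 3 = q * l ^ 2 * (q * l) := by ring
  rw [he]
  constructor
  · rintro ⟨⟨c, rfl⟩, h⟩
    rw [Nat.mul_div_cancel_left _ hpos] at h
    exact mul_dvd_mul_left _ h
  · rintro ⟨c, rfl⟩
    refine ⟨(dvd_mul_right _ _).mul_right _, ?_⟩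
    rw [mul_assoc, Nat.mul_div_cancel_left _ hpos]
    exact dvd_mul_right _ _

theorem sum_subringCount (N : ℕ) :
    ∑ n ∈ Finset.Icc 1 N, subringCount n =
      ∑ l ∈ Finset.Icc 1 N, ∑ q ∈ Finset.Icc 1 N with Squarefree q,
        q * l ^ 2 * (N / (q ^ 2 * l ^ 3)) := by
  have h1 : ∀ n ∈ Finset.Icc 1 N, subringCount n =
      ∑ d ∈ Finset.Icc 1 N, if d ∣ n ∧ d ∣ (n / d) ^ 2 then d else 0 := by
    intro n hn
    rw [Finset.mem_Icc] at hn
    rw [subringCount_eq (by omega), ← Finset.sum_filter]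
    refine Finset.sum_congr ?_ fun _ _ => rfl
    ext d
    simp only [Finset.mem_filter, Nat.mem_divisors, Finset.mem_Icc]
    constructor
    · rintro ⟨⟨h, -⟩, h'⟩
      have := Nat.le_of_dvd (by omega) h
      have := Nat.pos_of_dvd_of_pos h (by omega)
      exact ⟨by omega, h, h'⟩
    · rintro ⟨-, h, h'⟩
      exact ⟨⟨h, by omega⟩, h'⟩
  rw [Finset.sum_congr rfl h1, Finset.sum_comm]
  have h2 : ∀ q l : ℕ, Squarefree q → l ≠ 0 →
      (∑ n ∈ Finset.Icc 1 N,
        if q * l ^ 2 ∣ n ∧ q * l ^ 2 ∣ (n / (q * l ^ 2)) ^ 2 then q * l ^ 2 else 0) =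
      q * l ^ 2 * (N / (q ^ 2 * l ^ 3)) := by
    intro q l hq hl
    simp only [hq.dvd_and_dvd_div_sq_iff hl]
    rw [← Finset.sum_filter, Finset.sum_const, smul_eq_mul, mul_comm]
    congr 1
    exact Nat.Ioc_filter_dvd_card_eq_div N _
  have h3 : ∑ x ∈ Finset.Icc 1 N ×ˢ Finset.Icc 1 N with Squarefree x.2 ∧ x.2 * x.1 ^ 2 ≤ N,
      x.2 * x.1 ^ 2 * (N / (x.2 ^ 2 * x.1 ^ 3)) =
      ∑ l ∈ Finset.Icc 1 N, ∑ q ∈ Finset.Icc 1 N with Squarefree q,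
        q * l ^ 2 * (N / (q ^ 2 * l ^ 3)) := by
    rw [← Finset.sum_product']
    refine Finset.sum_subset ?_ ?_
    · intro x
      simp only [Finset.mem_filter, Finset.mem_product]
      tauto
    · intro x hx hx'
      simp only [Finset.mem_filter, Finset.mem_product, Finset.mem_Icc] at hx hx'
      -- The added pairs have `N < ql² ≤ q²l³`, so their quotient is zero.
      have h4 : N < x.2 * x.1 ^ 2 := by
        by_contra hcon
        exact hx' ⟨⟨hx.1, hx.2.1⟩, hx.2.2, not_lt.1 hcon⟩
      have h5 : x.2 * x.1 ^ 2 ≤ x.2 ^ 2 * x.1 ^ 3 :=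
        Nat.mul_le_mul (Nat.le_self_pow two_ne_zero _)
          (Nat.pow_le_pow_right hx.1.1 (by norm_num))
      rw [Nat.div_eq_of_lt (h4.trans_le h5), mul_zero]
  rw [← h3]
  symm
  refine Finset.sum_nbij (fun x => x.2 * x.1 ^ 2) ?_ ?_ ?_ ?_
  · rintro ⟨l, q⟩ hx
    simp only [Finset.mem_filter, Finset.mem_product, Finset.mem_Icc] at hx ⊢
    exact ⟨Nat.mul_pos hx.1.2.1 (pow_pos hx.1.1.1 2), hx.2.2⟩
  · rintro ⟨l, q⟩ hx ⟨m, r⟩ hy h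
    simp only [Finset.coe_filter, Finset.mem_product, Finset.mem_Icc, Set.mem_ofPred_eq] at hx hy
    obtain ⟨rfl, rfl⟩ := hx.2.1.mul_sq_inj hy.2.1 (by omega) (by omega) h
    rfl
  · intro d hd
    simp only [Finset.coe_Icc, Set.mem_Icc] at hd
    obtain ⟨q, l, hql, hq⟩ := Nat.sq_mul_squarefree d
    have hl : 0 < l := Nat.pos_of_ne_zero (by rintro rfl; simp at hql; omega)
    have hq0 : 0 < q := Nat.pos_of_ne_zero hq.ne_zero
    have h6 : l ≤ d := by rw [← hql]; nlinarith [Nat.le_self_pow two_ne_zero l]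
    have h7 : q ≤ d := by rw [← hql]; nlinarith [Nat.pow_pos (n := 2) hl]
    rw [mul_comm] at hql
    refine ⟨(l, q), ?_, hql⟩
    simp only [Finset.coe_filter, Finset.mem_product, Finset.mem_Icc, Set.mem_ofPred_eq]
    exact ⟨⟨⟨hl, by omega⟩, hq0, by omega⟩, hq, by omega⟩
  · rintro ⟨l, q⟩ hx
    simp only [Finset.mem_filter, Finset.mem_product, Finset.mem_Icc] at hx
    exact (h2 q l hx.2.1 (by omega)).symm

/-! ### Reciprocals of squarefree numbers -/

/-- For `n = ql²` with `q` squarefree, `j² ∣ n` means `j ∣ l`, and `∑_{j ∣ l} μ(j)` vanishes unless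
`l = 1`. -/
theorem sum_moebius_sq_dvd {n N : ℕ} (hn : n ≠ 0) (hN : n ≤ N) :
    (∑ j ∈ Finset.Icc 1 N with j ^ 2 ∣ n, ArithmeticFunction.moebius j) =
      if Squarefree n then 1 else 0 := by
  obtain ⟨q, l, hql, hq⟩ := Nat.sq_mul_squarefree n
  have hl : l ≠ 0 := by rintro rfl; simp at hql; omega
  rw [mul_comm] at hql
  have h1 : (Finset.Icc 1 N).filter (fun j => j ^ 2 ∣ n) = l.divisors := by
    ext j
    rw [Finset.mem_filter, Nat.mem_divisors, ← hql, hq.sq_dvd_mul_sq_iff hl, Finset.mem_Icc]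
    refine ⟨fun h => ⟨h.2, hl⟩, fun h => ⟨⟨Nat.pos_of_dvd_of_pos h.1 (Nat.pos_of_ne_zero hl), ?_⟩,
      h.1⟩⟩
    have := Nat.le_of_dvd (Nat.pos_of_ne_zero hl) h.1
    have := Nat.le_self_pow two_ne_zero l
    have : l ^ 2 ≤ n := hql ▸ Nat.le_mul_of_pos_left _ (Nat.pos_of_ne_zero hq.ne_zero)
    omega
  rw [h1, ← ArithmeticFunction.coe_mul_zeta_apply, ArithmeticFunction.moebius_mul_coe_zeta,
    ArithmeticFunction.one_apply]
  congr 1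
  rw [eq_iff_iff]
  constructor
  · rintro rfl
    rw [← hql]
    simpa using hq
  · intro h
    exact Nat.isUnit_iff.1 (h l (by rw [← hql, ← sq]; exact dvd_mul_left _ _))

theorem hasSum_moebius_div_sq :
    HasSum (fun j : ℕ => (ArithmeticFunction.moebius j : ℝ) / (j : ℝ) ^ 2)
      (1 / (riemannZeta 2).re) := by
  have h2 : 1 < (2 : ℂ).re := by norm_num
  have hz : riemannZeta 2 = (((riemannZeta 2).re : ℝ) : ℂ) := by
    rw [riemannZeta_two]
    norm_cast
  have hsum := (ArithmeticFunction.LSeriesSummable_moebius_iff.2 h2).hasSum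
  have hmul := ArithmeticFunction.LSeries_zeta_mul_Lseries_moebius h2
  rw [ArithmeticFunction.LSeries_zeta_eq_riemannZeta h2] at hmul
  have hval := eq_one_div_of_mul_eq_one_right hmul
  rw [LSeries] at hval
  rw [hval, hz] at hsum
  rw [← Complex.hasSum_ofReal]
  convert hsum using 1
  · ext j
    rcases eq_or_ne j 0 with rfl | hj
    · simp
    · rw [LSeries.term_of_ne_zero hj]
      push_cast
      norm_cast
  · push_cast
    rfl

theorem sum_inv_multiples (N : ℕ) {k : ℕ} (hk : k ≠ 0) :
    ∑ n ∈ Finset.Icc 1 N with k ∣ n, (n : ℝ)⁻¹ = (k : ℝ)⁻¹ * (harmonic (N / k) : ℝ) := by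
  have hk' : 0 < k := Nat.pos_of_ne_zero hk
  rw [harmonic_eq_sum_Icc]
  push_cast
  rw [Finset.mul_sum]
  symm
  refine Finset.sum_nbij (fun m => k * m) ?_ ?_ ?_ ?_
  · intro m hm
    rw [Finset.mem_Icc, Nat.le_div_iff_mul_le hk'] at hm
    rw [Finset.mem_filter, Finset.mem_Icc, mul_comm]
    exact ⟨⟨Nat.mul_pos hm.1 hk', hm.2⟩, dvd_mul_left _ _⟩
  · intro m _ m' _ h
    exact Nat.eq_of_mul_eq_mul_left hk' h
  · intro n hn
    simp only [Finset.coe_filter, Finset.mem_Icc, Set.mem_ofPred_eq] at hn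
    obtain ⟨m, rfl⟩ := hn.2
    refine ⟨m, ?_, rfl⟩
    rw [Finset.coe_Icc, Set.mem_Icc, Nat.le_div_iff_mul_le hk', mul_comm m]
    exact ⟨Nat.pos_of_mul_pos_left hn.1.1, hn.1.2⟩
  · intro m _
    push_cast
    rw [mul_inv]

/-- A finite sum in disguise, since `N / j ^ 2 = 0` for `j > N`; as a `HasSum` it can be compared
termwise with the series for `1/ζ(2)`. -/
theorem hasSum_moebius_mul_harmonic (N : ℕ) :
    HasSum (fun j : ℕ => (ArithmeticFunction.moebius j : ℝ) / (j : ℝ) ^ 2 *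
      (harmonic (N / j ^ 2) : ℝ)) (∑ q ∈ Finset.Icc 1 N with Squarefree q, (q : ℝ)⁻¹) := by
  have h1 : ∑ q ∈ Finset.Icc 1 N with Squarefree q, (q : ℝ)⁻¹ =
      ∑ j ∈ Finset.Icc 1 N, (ArithmeticFunction.moebius j : ℝ) / (j : ℝ) ^ 2 *
      (harmonic (N / j ^ 2) : ℝ) := by
    calc ∑ q ∈ Finset.Icc 1 N with Squarefree q, (q : ℝ)⁻¹
        = ∑ n ∈ Finset.Icc 1 N, ∑ j ∈ Finset.Icc 1 N,
            if j ^ 2 ∣ n then (ArithmeticFunction.moebius j : ℝ) * (n : ℝ)⁻¹ else 0 := by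
          rw [Finset.sum_filter]
          refine Finset.sum_congr rfl fun n hn => ?_
          rw [Finset.mem_Icc] at hn
          rw [← Finset.sum_filter, ← Finset.sum_mul, ← Int.cast_sum,
            sum_moebius_sq_dvd (by omega) hn.2]
          split_ifs <;> simp
      _ = _ := by
          rw [Finset.sum_comm]
          refine Finset.sum_congr rfl fun j hj => ?_
          rw [Finset.mem_Icc] at hj
          rw [← Finset.sum_filter, ← Finset.mul_sum,
            sum_inv_multiples N (pow_ne_zero 2 (by omega : j ≠ 0))]
          push_cast
          ring
  rw [h1]
  refine hasSum_sum_of_ne_finset_zero fun j hj => ?_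
  rcases Nat.eq_zero_or_pos j with rfl | hj0
  · simp
  · have hlt : N < j ^ 2 := by
      have := Nat.le_self_pow two_ne_zero j
      rw [Finset.mem_Icc] at hj
      omega
    rw [Nat.div_eq_of_lt hlt]
    simp

/-- The sum of the reciprocals of the squarefree numbers up to `x` is `log x / ζ(2) + O(1)`. -/
theorem exists_abs_sum_squarefree_inv_sub_le :
    ∃ C : ℝ, 0 ≤ C ∧ ∀ x : ℝ, 1 ≤ x →
      |∑ q ∈ Finset.Icc 1 ⌊x⌋₊ with Squarefree q, (q : ℝ)⁻¹ -
        1 / (riemannZeta 2).re * Real.log x| ≤ C := by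
  -- The 5 comes from `1 + 2 log j ≤ 5 j^(1/2)`, using `log j ≤ 2 j^(1/2)`.
  have hs : Summable fun j : ℕ => 5 * (1 / (j : ℝ) ^ (3 / 2 : ℝ)) :=
    (Real.summable_one_div_nat_rpow.2 (by norm_num)).mul_left 5
  refine ⟨∑' j : ℕ, 5 * (1 / (j : ℝ) ^ (3 / 2 : ℝ)), tsum_nonneg fun j => by positivity,
    fun x hx => ?_⟩
  have h1 := (hasSum_moebius_mul_harmonic ⌊x⌋₊).sub (hasSum_moebius_div_sq.mul_right (Real.log x))
  refine h1.norm_le_of_bounded hs.hasSum fun j => ?_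
  rcases Nat.eq_zero_or_pos j with rfl | hj
  · simp
  have hj1 : (1 : ℝ) ≤ j := by exact_mod_cast hj
  have hj0 : (0 : ℝ) < j := by linarith
  have hlogj : 0 ≤ Real.log j := Real.log_nonneg hj1
  have hlogx : 0 ≤ Real.log x := Real.log_nonneg hx
  have hkey : |(harmonic (⌊x⌋₊ / j ^ 2) : ℝ) - Real.log x| ≤ 1 + 2 * Real.log j := by
    have hfl : ⌊x⌋₊ / j ^ 2 = ⌊x / (j : ℝ) ^ 2⌋₊ := by
      rw [← Nat.floor_div_natCast]
      push_cast
      rfl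
    rw [hfl]
    have hlog : Real.log (x / (j : ℝ) ^ 2) = Real.log x - 2 * Real.log j := by
      rw [Real.log_div (by positivity) (by positivity), Real.log_pow]
      norm_num
    have hlow := log_le_harmonic_floor (x / (j : ℝ) ^ 2) (by positivity)
    rw [hlog] at hlow
    rw [abs_le]
    refine ⟨by linarith, ?_⟩
    rcases le_or_gt 1 (x / (j : ℝ) ^ 2) with h | h
    · have hup := harmonic_floor_le_one_add_log _ h
      rw [hlog] at hup
      linarith
    · rw [Nat.floor_eq_zero.2 h]
      simp
      linarith
  have hmu : |(ArithmeticFunction.moebius j : ℝ)| ≤ 1 := by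
    exact_mod_cast ArithmeticFunction.abs_moebius_le_one
  have hsqrt : (1 : ℝ) ≤ (j : ℝ) ^ (1 / 2 : ℝ) := Real.one_le_rpow hj1 (by norm_num)
  have hlogle : Real.log j ≤ (j : ℝ) ^ (1 / 2 : ℝ) / (1 / 2) :=
    Real.log_le_rpow_div hj0.le (by norm_num)
  have hpow : (j : ℝ) ^ 2 = (j : ℝ) ^ (1 / 2 : ℝ) * (j : ℝ) ^ (3 / 2 : ℝ) := by
    rw [← Real.rpow_add hj0, ← Real.rpow_natCast]
    norm_num
  rw [← mul_sub, Real.norm_eq_abs, abs_mul, abs_div, abs_of_pos (show 0 < (j : ℝ) ^ 2 by positivity)]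
  calc |(ArithmeticFunction.moebius j : ℝ)| / (j : ℝ) ^ 2 *
        |(harmonic (⌊x⌋₊ / j ^ 2) : ℝ) - Real.log x|
      ≤ 1 / (j : ℝ) ^ 2 * (5 * (j : ℝ) ^ (1 / 2 : ℝ)) := by
        gcongr
        linarith
    _ = 5 * (1 / (j : ℝ) ^ (3 / 2 : ℝ)) := by
        rw [hpow]
        field_simp

/-! ### Sums of `log l / l` -/

/-- Each step changes the error by at most `log (N + 1) - log N`, and these increments telescope. -/
theorem abs_sum_log_div_sub_le {N : ℕ} (hN : 1 ≤ N) :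
    |∑ l ∈ Finset.Icc 1 N, Real.log l / l - Real.log N ^ 2 / 2| ≤ Real.log N := by
  induction N, hN using Nat.le_induction with
  | base => simp
  | succ N hN ih =>
    rw [Finset.sum_Icc_succ_top (by omega)]
    have hN0 : (1 : ℝ) ≤ N := by exact_mod_cast hN
    push_cast
    set a := Real.log N
    set b := Real.log ((N : ℝ) + 1)
    have hb : b - a = Real.log (1 + 1 / N) := by
      rw [← Real.log_div (by positivity) (by positivity)]
      congr 1
      field_simp
    have h1 : b - a ≤ 1 / N := by
      rw [hb]
      have := Real.log_le_sub_one_of_pos (show (0 : ℝ) < 1 + 1 / N by positivity)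
      linarith
    have h2 : 1 / ((N : ℝ) + 1) ≤ b - a := by
      rw [hb]
      have := Real.one_sub_inv_le_log_of_pos (show (0 : ℝ) < 1 + 1 / N by positivity)
      refine le_trans (le_of_eq ?_) this
      field_simp
      ring
    have h3 : b ≤ N := by
      have := Real.log_le_sub_one_of_pos (show (0 : ℝ) < (N : ℝ) + 1 by positivity)
      simpa using this
    have ha0 : 0 ≤ a := Real.log_nonneg hN0
    have hpos : 0 < 1 / ((N : ℝ) + 1) := by positivity
    have hle1 : 1 / (N : ℝ) ≤ 1 := by rw [div_le_one (by positivity)]; exact hN0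
    have h4 : b / (N + 1) ≤ b * (b - a) := by
      rw [div_eq_mul_one_div]
      exact mul_le_mul_of_nonneg_left h2 (by linarith)
    have h5 : b * (b - a) ≤ b / (N + 1) + (b - a) := by
      calc b * (b - a) ≤ b * (1 / N) := mul_le_mul_of_nonneg_left h1 (by linarith)
        _ = b / (N + 1) + b / N * (1 / (N + 1)) := by field_simp
        _ ≤ b / (N + 1) + 1 * (b - a) := by
          gcongr
          rw [div_le_one (by positivity)]
          exact h3
        _ = _ := by ring
    rw [abs_le] at ih ⊢
    constructor <;> nlinarith

theorem log_sub_log_floor_le {x : ℝ} (hx : 1 ≤ x) : Real.log x - Real.log ⌊x⌋₊ ≤ 1 := by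
  have h1 : (1 : ℝ) ≤ (⌊x⌋₊ : ℝ) := by exact_mod_cast Nat.floor_pos.2 hx
  have h2 := Nat.lt_floor_add_one x
  rw [← Real.log_div (by positivity) (by positivity)]
  have h3 := Real.log_le_sub_one_of_pos (show 0 < x / (⌊x⌋₊ : ℝ) by positivity)
  have h4 : x / (⌊x⌋₊ : ℝ) ≤ 2 := by
    rw [div_le_iff₀ (by positivity)]
    linarith
  linarith

theorem abs_sum_floor_log_div_sub_le {x : ℝ} (hx : 1 ≤ x) :
    |∑ l ∈ Finset.Icc 1 ⌊x⌋₊, Real.log l / l - Real.log x ^ 2 / 2| ≤ 2 * Real.log x := by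
  have hN : 1 ≤ ⌊x⌋₊ := Nat.floor_pos.2 hx
  have h1 : (1 : ℝ) ≤ (⌊x⌋₊ : ℝ) := by exact_mod_cast hN
  have h2 := abs_sum_log_div_sub_le hN
  have h3 := log_sub_log_floor_le hx
  have h4 : Real.log ⌊x⌋₊ ≤ Real.log x :=
    Real.log_le_log (by positivity) (Nat.floor_le (by positivity))
  have h5 : 0 ≤ Real.log ⌊x⌋₊ := Real.log_nonneg h1
  rw [abs_le] at h2 ⊢
  constructor <;> nlinarith

/-! ### Asymptotics of the double sum -/

/-- The floor vanishes beyond `y = √(B/l³)`. Dropping it costs at most `yl²` for each of at most `y`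
values of `q`, in total `y²l² = B/l`; the estimate `hC` at `y` costs `CB/l`. -/
theorem abs_sum_squarefree_mul_floor_sub_le {C : ℝ}
    (hC : ∀ x : ℝ, 1 ≤ x → |∑ q ∈ Finset.Icc 1 ⌊x⌋₊ with Squarefree q, (q : ℝ)⁻¹ -
      1 / (riemannZeta 2).re * Real.log x| ≤ C)
    {B : ℝ} {l : ℕ} (hl : 1 ≤ l) (hlB : (l : ℝ) ^ 3 ≤ B) :
    |∑ q ∈ Finset.Icc 1 ⌊B⌋₊ with Squarefree q,
        ((q * l ^ 2 * (⌊B⌋₊ / (q ^ 2 * l ^ 3)) : ℕ) : ℝ) -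
      1 / (riemannZeta 2).re * (B / 2) * ((Real.log B - 3 * Real.log l) / l)| ≤
      (1 + C) * B * (l : ℝ)⁻¹ := by
  have hl1 : (1 : ℝ) ≤ l := by exact_mod_cast hl
  have hl0 : (0 : ℝ) < l := by linarith
  have hl3 : (1 : ℝ) ≤ (l : ℝ) ^ 3 := one_le_pow₀ hl1
  have hB0 : 0 < B := by linarith
  set y := √(B / (l : ℝ) ^ 3) with hy
  have hy2 : y ^ 2 = B / (l : ℝ) ^ 3 := Real.sq_sqrt (by positivity)
  have hy1 : 1 ≤ y := by
    rw [hy, Real.one_le_sqrt, one_le_div (by positivity)]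
    exact hlB
  have hyB : y ≤ B := by
    have : B / (l : ℝ) ^ 3 ≤ B := div_le_self hB0.le hl3
    nlinarith
  have hlogy : Real.log y = (Real.log B - 3 * Real.log l) / 2 := by
    rw [hy, Real.log_sqrt (by positivity), Real.log_div (by positivity) (by positivity),
      Real.log_pow]
    norm_num
  have hfloor : ∀ q : ℕ, ⌊B⌋₊ / (q ^ 2 * l ^ 3) = ⌊B / ((q : ℝ) ^ 2 * (l : ℝ) ^ 3)⌋₊ := by
    intro q
    rw [← Nat.floor_div_natCast]
    push_cast
    rfl
  have hrestrict : ∑ q ∈ Finset.Icc 1 ⌊B⌋₊ with Squarefree q,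
        ((q * l ^ 2 * (⌊B⌋₊ / (q ^ 2 * l ^ 3)) : ℕ) : ℝ) =
      ∑ q ∈ Finset.Icc 1 ⌊y⌋₊ with Squarefree q,
        ((q * l ^ 2 * (⌊B⌋₊ / (q ^ 2 * l ^ 3)) : ℕ) : ℝ) := by
    symm
    refine Finset.sum_subset ?_ ?_
    · exact Finset.filter_subset_filter _ (Finset.Icc_subset_Icc_right (Nat.floor_mono hyB))
    · intro q hq hq'
      simp only [Finset.mem_filter, Finset.mem_Icc] at hq hq'
      have hyq : y < q := by
        rw [← Nat.floor_lt (by positivity)]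
        by_contra hcon
        exact hq' ⟨⟨hq.1.1, not_lt.1 hcon⟩, hq.2⟩
      have hq0 : (0 : ℝ) < q := by linarith
      have : B / ((q : ℝ) ^ 2 * (l : ℝ) ^ 3) < 1 := by
        rw [div_lt_one (by positivity), ← div_lt_iff₀ (by positivity), ← hy2]
        gcongr
      rw [hfloor, Nat.floor_eq_zero.2 this]
      simp
  have hterm : ∀ q ∈ (Finset.Icc 1 ⌊y⌋₊).filter Squarefree,
      |((q * l ^ 2 * (⌊B⌋₊ / (q ^ 2 * l ^ 3)) : ℕ) : ℝ) - B / l * (q : ℝ)⁻¹| ≤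
        y * (l : ℝ) ^ 2 := by
    intro q hq
    simp only [Finset.mem_filter, Finset.mem_Icc] at hq
    have hq0 : (0 : ℝ) < q := by exact_mod_cast hq.1.1
    have hqy : (q : ℝ) ≤ y := (Nat.le_floor_iff (by positivity)).1 hq.1.2
    rw [hfloor]
    push_cast
    set z := B / ((q : ℝ) ^ 2 * (l : ℝ) ^ 3) with hz
    have hzeq : B / l * (q : ℝ)⁻¹ = q * (l : ℝ) ^ 2 * z := by
      rw [hz]
      field_simp
    rw [hzeq, ← mul_sub, abs_mul, abs_of_pos (by positivity : 0 < (q : ℝ) * (l : ℝ) ^ 2)]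
    have h1 : |(⌊z⌋₊ : ℝ) - z| ≤ 1 := by
      have := Nat.floor_le (show 0 ≤ z by positivity)
      have := Nat.lt_floor_add_one z
      rw [abs_le]
      constructor <;> linarith
    calc (q : ℝ) * (l : ℝ) ^ 2 * |(⌊z⌋₊ : ℝ) - z| ≤ y * (l : ℝ) ^ 2 * 1 := by gcongr
      _ = _ := mul_one _
  have hcard : (((Finset.Icc 1 ⌊y⌋₊).filter Squarefree).card : ℝ) ≤ y := by
    refine le_trans ?_ (Nat.floor_le (show 0 ≤ y by positivity))
    have := Finset.card_filter_le (Finset.Icc 1 ⌊y⌋₊) Squarefree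
    rw [Nat.card_Icc, Nat.add_sub_cancel] at this
    exact_mod_cast this
  have hfirst : |∑ q ∈ Finset.Icc 1 ⌊y⌋₊ with Squarefree q,
        ((q * l ^ 2 * (⌊B⌋₊ / (q ^ 2 * l ^ 3)) : ℕ) : ℝ) -
      B / l * ∑ q ∈ Finset.Icc 1 ⌊y⌋₊ with Squarefree q, (q : ℝ)⁻¹| ≤ B * (l : ℝ)⁻¹ := by
    rw [Finset.mul_sum, ← Finset.sum_sub_distrib]
    refine (Finset.abs_sum_le_sum_abs _ _).trans ((Finset.sum_le_card_nsmul _ _ _ hterm).trans ?_)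
    rw [nsmul_eq_mul]
    calc _ ≤ y * (y * (l : ℝ) ^ 2) := by gcongr
      _ = y ^ 2 * (l : ℝ) ^ 2 := by ring
      _ = B * (l : ℝ)⁻¹ := by
        rw [hy2]
        field_simp
  have hsecond : |B / l * ∑ q ∈ Finset.Icc 1 ⌊y⌋₊ with Squarefree q, (q : ℝ)⁻¹ -
      1 / (riemannZeta 2).re * (B / 2) * ((Real.log B - 3 * Real.log l) / l)| ≤
      C * B * (l : ℝ)⁻¹ := by
    have h1 : 1 / (riemannZeta 2).re * (B / 2) * ((Real.log B - 3 * Real.log l) / l) =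
        B / l * (1 / (riemannZeta 2).re * Real.log y) := by
      rw [hlogy]
      ring
    rw [h1, ← mul_sub, abs_mul, abs_of_pos (by positivity : 0 < B / (l : ℝ))]
    calc _ ≤ B / (l : ℝ) * C := by gcongr; exact hC y hy1
      _ = _ := by ring
  rw [hrestrict]
  calc _ ≤ _ := abs_sub_le _ (B / l * ∑ q ∈ Finset.Icc 1 ⌊y⌋₊ with Squarefree q, (q : ℝ)⁻¹) _
    _ ≤ B * (l : ℝ)⁻¹ + C * B * (l : ℝ)⁻¹ := add_le_add hfirst hsecond
    _ = _ := by ring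

/-- With `L = log B` the main term is `L · L/3 - 3 · (L/3)²/2 = L²/6`. The harmonic sum costs `L`
and the sum of `log l / l` costs `2L`. -/
theorem abs_sum_log_sub_three_mul_log_div_sub_le {B : ℝ} (hB : 1 ≤ B) :
    |∑ l ∈ Finset.Icc 1 ⌊B ^ (1 / 3 : ℝ)⌋₊, (Real.log B - 3 * Real.log l) / l -
      Real.log B ^ 2 / 6| ≤ 3 * Real.log B := by
  have hx1 : 1 ≤ B ^ (1 / 3 : ℝ) := Real.one_le_rpow hB (by norm_num)
  have hlogx : Real.log (B ^ (1 / 3 : ℝ)) = Real.log B / 3 := by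
    rw [Real.log_rpow (by positivity)]
    ring
  have h1 := log_le_harmonic_floor _ (zero_le_one.trans hx1)
  have h2 := harmonic_floor_le_one_add_log _ hx1
  have h3 := abs_sum_floor_log_div_sub_le hx1
  rw [hlogx] at h1 h2 h3
  rw [harmonic_eq_sum_Icc] at h1 h2
  push_cast at h1 h2
  have h4 : ∑ l ∈ Finset.Icc 1 ⌊B ^ (1 / 3 : ℝ)⌋₊, (Real.log B - 3 * Real.log l) / l =
      Real.log B * ∑ l ∈ Finset.Icc 1 ⌊B ^ (1 / 3 : ℝ)⌋₊, (l : ℝ)⁻¹ -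
      3 * ∑ l ∈ Finset.Icc 1 ⌊B ^ (1 / 3 : ℝ)⌋₊, Real.log l / l := by
    rw [Finset.mul_sum, Finset.mul_sum, ← Finset.sum_sub_distrib]
    refine Finset.sum_congr rfl fun l _ => ?_
    ring
  rw [h4]
  have hL : 0 ≤ Real.log B := Real.log_nonneg hB
  rw [abs_le] at h3 ⊢
  constructor <;> nlinarith

theorem exists_abs_sum_subringCount_sub_le :
    ∃ K : ℝ, ∀ B : ℝ, 1 ≤ B →
      |∑ n ∈ Finset.Icc 1 ⌊B⌋₊, (subringCount n : ℝ) -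
        1 / (12 * (riemannZeta 2).re) * (B * Real.log B ^ 2)| ≤
      K * (B * (1 + Real.log B)) := by
  obtain ⟨C, hC0, hC⟩ := exists_abs_sum_squarefree_inv_sub_le
  set c := 1 / (riemannZeta 2).re with hc
  refine ⟨1 + C + |c| * (3 / 2), fun B hB => ?_⟩
  have hL : 0 ≤ Real.log B := Real.log_nonneg hB
  have hB0 : 0 < B := by linarith
  set x := B ^ (1 / 3 : ℝ) with hx
  have hx1 : 1 ≤ x := Real.one_le_rpow hB (by norm_num)
  have hx3 : x ^ 3 = B := by
    rw [hx, ← Real.rpow_natCast, ← Real.rpow_mul hB0.le]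
    norm_num
  have hxB : x ≤ B := by
    rw [← hx3]
    exact le_self_pow₀ hx1 (by norm_num)
  have hrestrict : ∑ n ∈ Finset.Icc 1 ⌊B⌋₊, (subringCount n : ℝ) =
      ∑ l ∈ Finset.Icc 1 ⌊x⌋₊, ∑ q ∈ Finset.Icc 1 ⌊B⌋₊ with Squarefree q,
        ((q * l ^ 2 * (⌊B⌋₊ / (q ^ 2 * l ^ 3)) : ℕ) : ℝ) := by
    rw [← Nat.cast_sum, sum_subringCount]
    simp_rw [Nat.cast_sum]
    symm
    refine Finset.sum_subset (Finset.Icc_subset_Icc_right (Nat.floor_mono hxB)) ?_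
    intro l hl hl'
    rw [Finset.mem_Icc] at hl hl'
    have hxl : x < l := by
      rw [← Nat.floor_lt (by positivity)]
      omega
    have hBl : ⌊B⌋₊ < l ^ 3 := by
      rw [Nat.floor_lt hB0.le, ← hx3]
      push_cast
      gcongr
    refine Finset.sum_eq_zero fun q hq => ?_
    simp only [Finset.mem_filter, Finset.mem_Icc] at hq
    have : l ^ 3 ≤ q ^ 2 * l ^ 3 := Nat.le_mul_of_pos_left _ (pow_pos hq.1.1 2)
    rw [Nat.div_eq_of_lt (hBl.trans_le this)]
    simp
  have hfirst : |∑ n ∈ Finset.Icc 1 ⌊B⌋₊, (subringCount n : ℝ) -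
      c * (B / 2) * ∑ l ∈ Finset.Icc 1 ⌊x⌋₊, (Real.log B - 3 * Real.log l) / l| ≤
      (1 + C) * B * (1 + Real.log B) := by
    rw [hrestrict, Finset.mul_sum, ← Finset.sum_sub_distrib]
    calc _ ≤ ∑ l ∈ Finset.Icc 1 ⌊x⌋₊, (1 + C) * B * (l : ℝ)⁻¹ := by
          refine (Finset.abs_sum_le_sum_abs _ _).trans (Finset.sum_le_sum fun l hl => ?_)
          rw [Finset.mem_Icc] at hl
          refine abs_sum_squarefree_mul_floor_sub_le hC hl.1 ?_
          rw [← hx3]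
          have := (Nat.le_floor_iff (by positivity)).1 hl.2
          gcongr
      _ ≤ (1 + C) * B * (1 + Real.log B) := by
          rw [← Finset.mul_sum]
          have h1 := harmonic_floor_le_one_add_log x hx1
          rw [harmonic_eq_sum_Icc] at h1
          push_cast at h1
          have h2 : Real.log x ≤ Real.log B := Real.log_le_log (by positivity) hxB
          gcongr
          linarith
  have hsecond : |c * (B / 2) * ∑ l ∈ Finset.Icc 1 ⌊x⌋₊, (Real.log B - 3 * Real.log l) / l -
      1 / (12 * (riemannZeta 2).re) * (B * Real.log B ^ 2)| ≤
      |c| * (3 / 2) * (B * (1 + Real.log B)) := by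
    have h1 : 1 / (12 * (riemannZeta 2).re) * (B * Real.log B ^ 2) =
        c * (B / 2) * (Real.log B ^ 2 / 6) := by
      rw [hc, one_div, mul_inv, one_div]
      ring
    rw [h1, ← mul_sub, abs_mul, abs_mul, abs_of_pos (show 0 < B / 2 by positivity)]
    calc _ ≤ |c| * (B / 2) * (3 * (1 + Real.log B)) := by
          gcongr
          linarith [abs_sum_log_sub_three_mul_log_div_sub_le hB]
      _ = _ := by ring
  calc _ ≤ _ := abs_sub_le _
        (c * (B / 2) * ∑ l ∈ Finset.Icc 1 ⌊x⌋₊, (Real.log B - 3 * Real.log l) / l) _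
    _ ≤ (1 + C) * B * (1 + Real.log B) + |c| * (3 / 2) * (B * (1 + Real.log B)) :=
      add_le_add hfirst hsecond
    _ = _ := by ring

theorem corollary6 :
    (∀ n : ℕ, 1 ≤ n → (subringsOfIndex n).Finite) ∧
    Asymptotics.IsEquivalent Filter.atTop
      (fun B : ℝ => ∑ n ∈ Finset.Icc 1 ⌊B⌋₊, (subringCount n : ℝ))
      (fun B : ℝ => 1 / (12 * (riemannZeta 2).re) * (B * Real.log B ^ 2)) := by
  refine ⟨fun n hn => subringsOfIndex_finite (by omega), ?_⟩
  obtain ⟨K, hK⟩ := exists_abs_sum_subringCount_sub_le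
  -- A nonzero constant lets `o(B log² B)` become little-o of the stated main term.
  have hz : (1 / (12 * (riemannZeta 2).re)) ≠ 0 := by
    have : (riemannZeta 2).re = Real.pi ^ 2 / 6 := by
      rw [riemannZeta_two]
      norm_cast
    rw [this]
    positivity
  have hO : (fun B : ℝ => ∑ n ∈ Finset.Icc 1 ⌊B⌋₊, (subringCount n : ℝ) -
      1 / (12 * (riemannZeta 2).re) * (B * Real.log B ^ 2)) =O[Filter.atTop]
      fun B : ℝ => B * (1 + Real.log B) := by
    refine Asymptotics.IsBigO.of_bound K ?_
    filter_upwards [Filter.eventually_ge_atTop 1] with B hB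
    have : 0 ≤ Real.log B := Real.log_nonneg hB
    rw [Real.norm_eq_abs, Real.norm_of_nonneg (by positivity)]
    exact hK B hB
  have ho : (fun B : ℝ => 1 + Real.log B) =o[Filter.atTop] fun B : ℝ => Real.log B ^ 2 := by
    have h1 : (fun y : ℝ => 1 + y) =o[Filter.atTop] fun y : ℝ => y ^ 2 := by
      have h0 := Asymptotics.isLittleO_pow_pow_atTop_of_lt (𝕜 := ℝ) (show 0 < 2 by norm_num)
      have h1 := Asymptotics.isLittleO_pow_pow_atTop_of_lt (𝕜 := ℝ) (show 1 < 2 by norm_num)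
      simpa using h0.add h1
    exact h1.comp_tendsto Real.tendsto_log_atTop
  exact hO.trans_isLittleO
    (((Asymptotics.isBigO_refl (fun B : ℝ => B) _).mul_isLittleO ho).const_mul_right hz)
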